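/- Let $T$ be a unital, not necessarily associative ring, let $n\ge 1$, and let $\sigma_1,\dots,\sigma_n$ be pairwise commuting ring automorphisms of $T$. For $m=(m_1,\dots,m_n)\in\mathbb{Z}^n$ put $\sigma^m=\sigma_1^{m_1}\circ\cdots\circ\sigma_n^{m_n}$. The non-associative skew Laurent polynomial ring $R=T[x_1^{\pm1},\dots,x_n^{\pm1};\sigma_1,\dots,\sigma_n]$ is the set of finite formal sums $\sum_{m\in\mathbb{Z}^n}t_m x^m$ with $t_m\in T$, equipped with coordinate-wise addition and with the bi-additive multiplication determined by $(a x^m)(b x^k)=a\,\sigma^m(b)\,x^{m+k}$ for $a,b\in T$ and $m,k\in\mathbb{Z}^n$. A unital non-associative ring is called simple if it is non-zero and its only two-sided ideals are $\{0\}$ and the ring itself. The ring $T$ is called $(\sigma_1,\dots,\sigma_n)$-simple if it is non-zero and it has no two-sided ideal $I$, other than $\{0\}$ and $T$, such that $\sigma_i(I)\subseteq I$ for all $i\in\{1,\dots,n\}$. Let $N(T)$ denote the nucleus of $T$, i.e. the set of all $u\in T$ such that the associators $(u,s,t)$, $(s,u,t)$ and $(s,t,u)$ vanish for all $s,t\in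 T$, where $(r,s,t)=(rs)t-r(st)$; it is an associative unital subring of $T$, with group of units $N(T)^\times$. **Theorem.** The ring $R$ is simple if and only if the following two conditions hold: 1. $T$ is $(\sigma_1,\dots,\sigma_n)$-simple; 2. there do not exist $u\in N(T)^\times$ with $\sigma_i(u)=u$ for all $i\in\{1,\dots,n\}$, and a non-zero $m\in\mathbb{Z}^n$, such that $\sigma^m(t)=u t u^{-1}$ for every $t\in T$. -/

import Mathlib

/-- The nucleus `N(T)` of a (not necessarily associative) ring: the intersection of the left, the
middle and the right nucleus. -/
def nucleus (T : Type*) [NonAssocRing T] : Set T :=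
  {u | (∀ s t : T, associator u s t = 0) ∧ (∀ r t : T, associator r u t = 0) ∧
    (∀ r s : T, associator r s u = 0)}

/-- The automorphism `σ₁ ^ m₁ ∘ ⋯ ∘ σₙ ^ mₙ` (multiplication in `RingAut T` is composition). -/
def powComp {T : Type*} [NonAssocRing T] {n : ℕ} (σ : Fin n → RingAut T) (m : Fin n → ℤ) :
    RingAut T :=
  (List.ofFn fun i => σ i ^ m i).prod

theorem powComp_zero {T : Type*} [NonAssocRing T] {n : ℕ} (σ : Fin n → RingAut T) :
    powComp σ 0 = 1 := by
  unfold powComp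
  apply List.prod_eq_one
  intro x hx
  obtain ⟨i, rfl⟩ := (List.mem_ofFn' _ _).1 hx
  simp

/-- The non-associative skew Laurent polynomial ring `T[x₁^{±1}, …, xₙ^{±1}; σ₁, …, σₙ]`: its
elements are the finite sums `∑ tₘ x^m` with `tₘ ∈ T` and `m ∈ ℤⁿ`, stored as the finitely
supported functions `m ↦ tₘ`. (It is the skew group ring of `ℤⁿ` when the `σᵢ` commute.) -/
def SkewLaurent {T : Type*} [NonAssocRing T] {n : ℕ} (_σ : Fin n → RingAut T) : Type _ :=
  (Fin n → ℤ) →₀ T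

namespace SkewLaurent

variable {T : Type*} [NonAssocRing T] {n : ℕ} {σ : Fin n → RingAut T}

/-- Addition is coordinate-wise. -/
noncomputable instance : AddCommGroup (SkewLaurent σ) :=
  inferInstanceAs (AddCommGroup ((Fin n → ℤ) →₀ T))

/-- The monomial `t x^m`. -/
noncomputable def monomial (σ : Fin n → RingAut T) (m : Fin n → ℤ) : T →+ SkewLaurent σ :=
  Finsupp.singleAddHom m

/-- The bi-additive extension of `(a x^m) (b x^k) = (a σ^m(b)) x^(m + k)`. -/
noncomputable def mulHom (σ : Fin n → RingAut T) :
    SkewLaurent σ →+ SkewLaurent σ →+ SkewLaurent σ :=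
  Finsupp.liftAddHom fun m => AddMonoidHom.flip <| Finsupp.liftAddHom fun k =>
    AddMonoidHom.flip <| AddMonoidHom.mk'
      (fun a => (monomial σ (m + k)).comp
        ((AddMonoidHom.mulLeft a).comp (powComp σ m : T ≃+* T).toAddEquiv.toAddMonoidHom))
      (fun a b => by
        ext t
        simp [add_mul])

noncomputable instance : Mul (SkewLaurent σ) := ⟨fun f g => mulHom σ f g⟩

noncomputable instance : One (SkewLaurent σ) := ⟨monomial σ 0 1⟩

theorem mul_def (f g : SkewLaurent σ) : f * g = mulHom σ f g := rfl

theorem one_def : (1 : SkewLaurent σ) = monomial σ 0 1 := rfl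

theorem monomial_mul_monomial (m k : Fin n → ℤ) (a b : T) :
    monomial σ m a * monomial σ k b = monomial σ (m + k) (a * powComp σ m b) := by
  simp only [mul_def]
  unfold mulHom
  erw [Finsupp.liftAddHom_apply_single]
  erw [AddMonoidHom.flip_apply, Finsupp.liftAddHom_apply_single]
  rfl

theorem induction_on {p : SkewLaurent σ → Prop} (f : SkewLaurent σ) (h0 : p 0)
    (hadd : ∀ f g, p f → p g → p (f + g)) (hmon : ∀ m a, p (monomial σ m a)) : p f :=
  Finsupp.induction_linear f h0 hadd hmon

noncomputable instance : NonAssocRing (SkewLaurent σ) :=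
  { (inferInstance : AddCommGroup (SkewLaurent σ)),
    (inferInstance : Mul (SkewLaurent σ)),
    (inferInstance : One (SkewLaurent σ)) with
    left_distrib := fun f g h => by simp only [mul_def, map_add]
    right_distrib := fun f g h => by simp only [mul_def, map_add, AddMonoidHom.add_apply]
    zero_mul := fun f => by simp only [mul_def, map_zero, AddMonoidHom.zero_apply]
    mul_zero := fun f => by simp only [mul_def, map_zero]
    one_mul := fun f => by
      induction f using induction_on with
      | h0 => simp only [mul_def, map_zero]
      | hadd f g hf hg => simp only [mul_def, map_add] at hf hg ⊢; rw [hf, hg]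
      | hmon m a => rw [one_def, monomial_mul_monomial, powComp_zero]; simp
    mul_one := fun f => by
      induction f using induction_on with
      | h0 => simp only [mul_def, map_zero, AddMonoidHom.zero_apply]
      | hadd f g hf hg =>
        simp only [mul_def, map_add, AddMonoidHom.add_apply] at hf hg ⊢; rw [hf, hg]
      | hmon m a => rw [one_def, monomial_mul_monomial]; simp }

end SkewLaurent

/-- `T` is `(σ₁, …, σₙ)`-simple: `T` is non-zero and has no two-sided ideal `I` with `σᵢ(I) ⊆ I` for
all `i`, other than `{0}` and `T`. -/
def IsSigmaSimple {T : Type*} [NonAssocRing T] {n : ℕ} (σ : Fin n → RingAut T) : Prop :=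
  Nontrivial T ∧ ∀ I : TwoSidedIdeal T, (∀ i, ∀ t ∈ I, σ i t ∈ I) → I = ⊥ ∨ I = ⊤

/-! ### Powers of commuting automorphisms. -/

section PowComp

variable {T : Type*} [NonAssocRing T] {n : ℕ} {σ : Fin n → RingAut T}

/-! Conditions 1 and 2 exclude the two sources of proper ideals of `R`. A σ-invariant ideal of `T`
yields, after saturation, the ideal of elements with coefficients in it
(`IsSimpleRing.isSigmaSimple`). If `σ^m` is conjugation by a fixed nuclear unit `u` and `m ≠ 0`,
then `c = u⁻¹ x^m` is central and nuclear enough for `(1 - c)R` to be an ideal; finiteness of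
supports keeps `1` out of it (`sub_monomial_mul_ne_one`).

Conversely, let `I ≠ 0`. By σ-simplicity, `I` contains an `f` of minimal support with constant
coefficient `1` (`exists_monic_minimal`). Commutators and associators of `f` with constants, and
`x_i f x_i⁻¹ - f`, lie in `I`, have no new exponents and lose the exponent `0`; hence they vanish.
So each coefficient `w` of `f` at `m` is nuclear, σ-fixed and satisfies `t w = w σ^m(t)`. If `w ≠
0`, σ-simplicity makes it a unit (`IsSigmaSimple.exists_inverse`), and `w⁻¹` violates condition 2
unless `m = 0`. Thus `f = 1`. -/

theorem powComp_mem {P : Submonoid (RingAut T)} {m : Fin n → ℤ} (h : ∀ i, σ i ^ m i ∈ P) :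
    powComp σ m ∈ P := by
  apply Submonoid.list_prod_mem
  intro x hx
  obtain ⟨i, rfl⟩ := (List.mem_ofFn' _ _).1 hx
  exact h i

theorem List.prod_ofFn_mul_of_commute {G : Type*} [Monoid G] :
    ∀ {n : ℕ} (f g : Fin n → G), (∀ i j, Commute (f i) (g j)) →
      (List.ofFn fun i => f i * g i).prod = (List.ofFn f).prod * (List.ofFn g).prod
  | 0, _, _, _ => by simp
  | n + 1, f, g, h => by
    have hc : Commute (List.ofFn fun i : Fin n => f i.succ).prod (g 0) := by
      apply Commute.list_prod_left
      intro x hx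
      obtain ⟨i, rfl⟩ := (List.mem_ofFn' _ _).1 hx
      exact h _ _
    simp only [List.ofFn_succ, List.prod_cons]
    rw [List.prod_ofFn_mul_of_commute _ _ fun i j => h i.succ j.succ, mul_assoc, mul_assoc,
      ← mul_assoc (g 0), ← hc.eq, mul_assoc]

theorem List.prod_ofFn_pi_single {G : Type*} [Monoid G] {n : ℕ} (i : Fin n) (a : G) :
    (List.ofFn (Pi.mulSingle i a : Fin n → G)).prod = a := by
  induction n with
  | zero => exact i.elim0
  | succ n ih =>
    rw [List.ofFn_succ, List.prod_cons]
    cases i using Fin.cases with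
    | zero =>
      have : (List.ofFn fun j : Fin n => (Pi.mulSingle 0 a : Fin (n + 1) → G) j.succ).prod = 1 := by
        apply List.prod_eq_one
        intro x hx
        obtain ⟨j, rfl⟩ := (List.mem_ofFn' _ _).1 hx
        simp
      rw [this]
      simp
    | succ i =>
      have : (fun j : Fin n => (Pi.mulSingle i.succ a : Fin (n + 1) → G) j.succ) =
          Pi.mulSingle i a := by
        ext j
        simp [Pi.mulSingle_apply]
      rw [this, ih]
      simp

theorem powComp_add (hσ : ∀ i j, Commute (σ i) (σ j)) (m k : Fin n → ℤ) :
    powComp σ (m + k) = powComp σ m * powComp σ k := by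
  unfold powComp
  rw [← List.prod_ofFn_mul_of_commute _ _ fun i j => ((hσ i j).zpow_left _).zpow_right _]
  simp [zpow_add]

theorem powComp_add_apply (hσ : ∀ i j, Commute (σ i) (σ j)) (m k : Fin n → ℤ) (t : T) :
    powComp σ (m + k) t = powComp σ m (powComp σ k t) := by
  rw [powComp_add hσ]
  rfl

theorem powComp_single (σ : Fin n → RingAut T) (i : Fin n) :
    powComp σ (Pi.single i 1) = σ i := by
  unfold powComp
  have h : (fun j => σ j ^ (Pi.single i 1 : Fin n → ℤ) j) = Pi.mulSingle i (σ i) := by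
    refine funext fun j => ?_
    obtain rfl | h := eq_or_ne j i
    · simp
    · simp [h]
  rw [h, List.prod_ofFn_pi_single]

theorem powComp_zero_apply (t : T) : powComp σ 0 t = t := by
  rw [powComp_zero]
  rfl

theorem powComp_fixed {t : T} (ht : ∀ i, σ i t = t) (m : Fin n → ℤ) : powComp σ m t = t := by
  let P : Subgroup (RingAut T) :=
    { carrier := {φ | φ t = t}
      mul_mem' := fun {φ ψ} hφ hψ => (congrArg φ hψ).trans hφ
      one_mem' := rfl
      inv_mem' := fun {φ} hφ => φ.symm_apply_eq.2 (Eq.symm hφ) }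
  exact powComp_mem (P := P.toSubmonoid) fun i => zpow_mem (K := P) (ht i) _

/-- Only `σ i` maps `I` into itself; its inverse need not, hence the sign condition. -/
theorem powComp_mem_of_nonneg {I : TwoSidedIdeal T} (hI : ∀ i, ∀ t ∈ I, σ i t ∈ I)
    {m : Fin n → ℤ} (hm : 0 ≤ m) {t : T} (ht : t ∈ I) : powComp σ m t ∈ I := by
  let P : Submonoid (RingAut T) :=
    { carrier := {φ | ∀ t ∈ I, φ t ∈ I}
      mul_mem' := fun hφ hψ t ht => hφ _ (hψ t ht)
      one_mem' := fun _ ht => ht }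
  refine powComp_mem (P := P) (fun i => ?_) t ht
  obtain ⟨k, hk⟩ := Int.eq_ofNat_of_zero_le (hm i)
  rw [hk, zpow_natCast]
  exact pow_mem (S := P) (hI i) k

end PowComp

/-! ### Units of the nucleus. -/

section Nucleus

variable {T : Type*} [NonAssocRing T] {u v : T}

theorem mul_assoc_of_left_mem_nucleus (hu : u ∈ nucleus T) (s t : T) :
    u * s * t = u * (s * t) := sub_eq_zero.1 (hu.1 s t)

theorem mul_assoc_of_mid_mem_nucleus (hu : u ∈ nucleus T) (s t : T) :
    s * u * t = s * (u * t) := sub_eq_zero.1 (hu.2.1 s t)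

theorem mul_assoc_of_right_mem_nucleus (hu : u ∈ nucleus T) (s t : T) :
    s * t * u = s * (t * u) := sub_eq_zero.1 (hu.2.2 s t)

/-- Nuclearity of `u` alone makes multiplication by `v` invert multiplication by `u` on either side,
so the identities for `v` follow by inserting and cancelling `u`. -/
theorem mem_nucleus_of_inverse (hu : u ∈ nucleus T) (huv : u * v = 1) (hvu : v * u = 1) :
    v ∈ nucleus T := by
  have l := mul_assoc_of_left_mem_nucleus hu
  have c := mul_assoc_of_mid_mem_nucleus hu
  have r := mul_assoc_of_right_mem_nucleus hu
  have huvx (x : T) : u * (v * x) = x := by rw [← l, huv, one_mul]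
  have hvux (x : T) : v * (u * x) = x := by rw [← c, hvu, one_mul]
  have hxvu (x : T) : x * v * u = x := by rw [r, hvu, mul_one]
  have hxuv (x : T) : x * u * v = x := by rw [c, huv, mul_one]
  refine ⟨fun s t => sub_eq_zero.2 ?_, fun s t => sub_eq_zero.2 ?_, fun s t => sub_eq_zero.2 ?_⟩
  · rw [← hvux (v * s * t), ← l, huvx]
  · conv_lhs => rw [← huvx t, ← c, hxvu]
  · rw [← hxuv (s * (t * v)), r, hxvu]

theorem map_eq_of_inverse (hu : u ∈ nucleus T) (huv : u * v = 1) (hvu : v * u = 1)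
    {φ : RingAut T} (hφ : φ u = u) : φ v = v := by
  have h : u * φ v = 1 := by
    have := congrArg φ huv
    rwa [map_mul, hφ, map_one] at this
  rw [← one_mul (φ v), ← hvu, mul_assoc_of_mid_mem_nucleus hu, h, mul_one]

end Nucleus

/-! ### Coefficient calculus in `R`. -/

namespace SkewLaurent

variable {T : Type*} [NonAssocRing T] {n : ℕ} {σ : Fin n → RingAut T}

/-- The coefficient of `x^k`. -/
noncomputable def coeff (k : Fin n → ℤ) : SkewLaurent σ →+ T :=
  Finsupp.applyAddHom k

/-- The exponents whose coefficient is non-zero. -/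
noncomputable def support (f : SkewLaurent σ) : Finset (Fin n → ℤ) :=
  Finsupp.support (M := T) f

theorem mem_support {f : SkewLaurent σ} {k : Fin n → ℤ} : k ∈ f.support ↔ coeff k f ≠ 0 :=
  Finsupp.mem_support_iff

theorem ext_coeff {f g : SkewLaurent σ} (h : ∀ k, coeff k f = coeff k g) : f = g :=
  Finsupp.ext h

theorem coeff_monomial (m k : Fin n → ℤ) (a : T) :
    coeff k (monomial σ m a) = if m = k then a else 0 := by
  classical
  exact Finsupp.single_apply

theorem coeff_one (k : Fin n → ℤ) :
    coeff k (1 : SkewLaurent σ) = if 0 = k then 1 else 0 :=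
  coeff_monomial 0 k 1

theorem coeff_zero_one : coeff 0 (1 : SkewLaurent σ) = 1 := by
  simp [coeff_one]

theorem coeff_monomial_mul (m k : Fin n → ℤ) (a : T) (f : SkewLaurent σ) :
    coeff k (monomial σ m a * f) = a * powComp σ m (coeff (k - m) f) := by
  induction f using induction_on with
  | h0 => simp
  | hadd f g hf hg => simp only [mul_add, map_add, hf, hg]
  | hmon l b =>
    rw [monomial_mul_monomial, coeff_monomial, coeff_monomial]
    by_cases h : m + l = k
    · rw [if_pos h, if_pos (eq_sub_of_add_eq' h)]
    · rw [if_neg h, if_neg fun h' => h (add_eq_of_eq_sub' h')]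
      simp

theorem coeff_mul_monomial (m k : Fin n → ℤ) (a : T) (f : SkewLaurent σ) :
    coeff k (f * monomial σ m a) = coeff (k - m) f * powComp σ (k - m) a := by
  induction f using induction_on with
  | h0 => simp
  | hadd f g hf hg => simp only [add_mul, map_add, hf, hg]
  | hmon l b =>
    rw [monomial_mul_monomial, coeff_monomial, coeff_monomial]
    by_cases h : l + m = k
    · rw [if_pos h, if_pos (eq_sub_of_add_eq h), eq_sub_of_add_eq h]
    · rw [if_neg h, if_neg fun h' => h (add_eq_of_eq_sub h')]
      simp

theorem coeff_C_mul (k : Fin n → ℤ) (a : T) (f : SkewLaurent σ) :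
    coeff k (monomial σ 0 a * f) = a * coeff k f := by
  rw [coeff_monomial_mul, sub_zero, powComp_zero_apply]

theorem coeff_mul_C (k : Fin n → ℤ) (a : T) (f : SkewLaurent σ) :
    coeff k (f * monomial σ 0 a) = coeff k f * powComp σ k a := by
  rw [coeff_mul_monomial, sub_zero]

/-- Conjugation by `x^m` twists coefficients without moving exponents; this is how σ-stability is
read off inside ideals of `R`. -/
theorem coeff_conj (k m : Fin n → ℤ) (f : SkewLaurent σ) :
    coeff k (monomial σ m 1 * f * monomial σ (-m) 1) = powComp σ m (coeff k f) := by
  rw [coeff_mul_monomial, coeff_monomial_mul]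
  simp

theorem support_shift_card_le (m : Fin n → ℤ) (f : SkewLaurent σ) :
    (f * monomial σ m 1).support.card ≤ f.support.card := by
  classical
  refine (Finset.card_le_card (t := f.support.image (· + m)) fun k hk => ?_).trans
    Finset.card_image_le
  rw [mem_support, coeff_mul_monomial, map_one, mul_one] at hk
  exact Finset.mem_image.2 ⟨k - m, mem_support.2 hk, sub_add_cancel _ _⟩

theorem nontrivial_iff : Nontrivial (SkewLaurent σ) ↔ Nontrivial T := by
  rw [← not_subsingleton_iff_nontrivial, ← not_subsingleton_iff_nontrivial]
  refine not_congr ⟨fun _ => ?_, fun _ => ⟨fun f g => ext_coeff fun k => Subsingleton.elim _ _⟩⟩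
  refine subsingleton_of_zero_eq_one ?_
  rw [← coeff_zero_one (σ := σ), ← Subsingleton.elim (0 : SkewLaurent σ) 1, map_zero]

/-- The ideal of the elements all of whose coefficients lie in a `σ`-stable ideal of `T`. -/
noncomputable def coeffIdeal (J : TwoSidedIdeal T) (hJ : ∀ m, ∀ t ∈ J, powComp σ m t ∈ J) :
    TwoSidedIdeal (SkewLaurent σ) :=
  TwoSidedIdeal.mk' {f | ∀ k, coeff k f ∈ J}
    (fun k => by simp)
    (fun hf hg k => by simpa using J.add_mem (hf k) (hg k))
    (fun hf k => by simpa using J.neg_mem (hf k))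
    (fun {f g} hg => by
      induction f using induction_on with
      | h0 => intro k; simp
      | hadd f f' hf hf' => intro k; rw [add_mul, map_add]; exact J.add_mem (hf k) (hf' k)
      | hmon m a =>
        intro k
        rw [coeff_monomial_mul]
        exact J.mul_mem_left _ _ (hJ _ _ (hg _)))
    (fun {f g} hf => by
      induction g using induction_on with
      | h0 => intro k; simp
      | hadd g g' hg hg' => intro k; rw [mul_add, map_add]; exact J.add_mem (hg k) (hg' k)
      | hmon m a =>
        intro k
        rw [coeff_mul_monomial]
        exact J.mul_mem_right _ _ (hf _))

theorem mem_coeffIdeal {J : TwoSidedIdeal T} {hJ : ∀ m, ∀ t ∈ J, powComp σ m t ∈ J}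
    {f : SkewLaurent σ} : f ∈ coeffIdeal J hJ ↔ ∀ k, coeff k f ∈ J :=
  TwoSidedIdeal.mem_mk' ..

end SkewLaurent

/-! ### Simplicity of `R` forces σ-simplicity of `T`. -/

section SigmaSimple

open SkewLaurent

variable {T : Type*} [NonAssocRing T] {n : ℕ} {σ : Fin n → RingAut T}

/-- The union of the preimages of a `σ`-invariant ideal under the non-negative powers of `σ`. -/
def sigmaSaturation (hσ : ∀ i j, Commute (σ i) (σ j)) (I : TwoSidedIdeal T)
    (hI : ∀ i, ∀ t ∈ I, σ i t ∈ I) : TwoSidedIdeal T :=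
  TwoSidedIdeal.mk' {t | ∃ p : Fin n → ℤ, 0 ≤ p ∧ powComp σ p t ∈ I}
    ⟨0, le_rfl, by simp⟩
    (fun {x y} ⟨p, hp, hx⟩ ⟨q, hq, hy⟩ => ⟨p + q, add_nonneg hp hq, by
      rw [map_add]
      refine I.add_mem ?_ ?_
      · rw [add_comm p q, powComp_add_apply hσ]
        exact powComp_mem_of_nonneg hI hq hx
      · rw [powComp_add_apply hσ]
        exact powComp_mem_of_nonneg hI hp hy⟩)
    (fun ⟨p, hp, hx⟩ => ⟨p, hp, by rw [map_neg]; exact I.neg_mem hx⟩)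
    (fun ⟨p, hp, hx⟩ => ⟨p, hp, by rw [map_mul]; exact I.mul_mem_left _ _ hx⟩)
    (fun ⟨p, hp, hx⟩ => ⟨p, hp, by rw [map_mul]; exact I.mul_mem_right _ _ hx⟩)

theorem mem_sigmaSaturation {hσ : ∀ i j, Commute (σ i) (σ j)} {I : TwoSidedIdeal T}
    {hI : ∀ i, ∀ t ∈ I, σ i t ∈ I} {t : T} :
    t ∈ sigmaSaturation hσ I hI ↔ ∃ p : Fin n → ℤ, 0 ≤ p ∧ powComp σ p t ∈ I :=
  TwoSidedIdeal.mem_mk' ..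

theorem powComp_mem_sigmaSaturation (hσ : ∀ i j, Commute (σ i) (σ j)) (I : TwoSidedIdeal T)
    (hI : ∀ i, ∀ t ∈ I, σ i t ∈ I) (m : Fin n → ℤ) (t : T) (ht : t ∈ sigmaSaturation hσ I hI) :
    powComp σ m t ∈ sigmaSaturation hσ I hI := by
  obtain ⟨p, hp, ht⟩ := mem_sigmaSaturation.1 ht
  -- Adding `|m|` offsets the negative entries of `m`: what acts after `p` is `|m| + m ≥ 0`.
  refine mem_sigmaSaturation.2 ⟨p + |m|, add_nonneg hp (abs_nonneg m), ?_⟩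
  rw [← powComp_add_apply hσ, show p + |m| + m = |m| + m + p by abel, powComp_add_apply hσ]
  refine powComp_mem_of_nonneg hI ?_ ht
  have := neg_le_abs m
  simpa using add_le_add_left this m

/-- The saturation of `I` is stable under negative powers too, so it induces an ideal of `R`.
Saturating cannot make a proper ideal improper, because automorphisms fix `1`. -/
theorem IsSimpleRing.isSigmaSimple (hσ : ∀ i j, Commute (σ i) (σ j))
    [IsSimpleRing (SkewLaurent σ)] : IsSigmaSimple σ := by
  refine ⟨nontrivial_iff.1 (inferInstance : Nontrivial (SkewLaurent σ)), fun I hI => ?_⟩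
  rw [or_iff_not_imp_left]
  intro hne
  let K := coeffIdeal _ (powComp_mem_sigmaSaturation hσ I hI)
  obtain ⟨t, ht, ht0⟩ : ∃ t ∈ I, t ≠ 0 := by
    by_contra! h
    exact hne (le_bot_iff.1 fun t ht => (TwoSidedIdeal.mem_bot T).2 (h t ht))
  have hK : monomial σ 0 t ∈ K := mem_coeffIdeal.2 fun k => by
    rw [coeff_monomial]
    split_ifs
    · exact mem_sigmaSaturation.2 ⟨0, le_rfl, by rwa [powComp_zero_apply]⟩
    · exact TwoSidedIdeal.zero_mem _
  have h0 : monomial σ 0 t ≠ 0 := fun h => ht0 <| by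
    simpa [coeff_monomial] using congrArg (coeff 0) h
  have h1 := mem_coeffIdeal.1 (IsSimpleRing.one_mem_of_ne_zero_mem K h0 hK) 0
  rw [coeff_zero_one] at h1
  obtain ⟨p, -, hp⟩ := mem_sigmaSaturation.1 h1
  rw [map_one] at hp
  exact (TwoSidedIdeal.one_mem_iff I).1 hp

end SigmaSimple

namespace SkewLaurent

variable {T : Type*} [NonAssocRing T] {n : ℕ} {σ : Fin n → RingAut T}

/-! ### The ideal generated by `1 - v x^m`. -/

section Central

variable {v : T} {m : Fin n → ℤ}

theorem monomial_mul_mul (hσ : ∀ i j, Commute (σ i) (σ j)) (hv : v ∈ nucleus T)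
    (f g : SkewLaurent σ) :
    monomial σ m v * f * g = monomial σ m v * (f * g) := by
  induction f using induction_on with
  | h0 => simp
  | hadd f f' hf hf' => simp only [mul_add, add_mul, hf, hf']
  | hmon k a =>
    induction g using induction_on with
    | h0 => simp
    | hadd g g' hg hg' => simp only [mul_add, hg, hg']
    | hmon l b =>
      simp only [monomial_mul_monomial, map_mul, powComp_add_apply hσ,
        mul_assoc_of_left_mem_nucleus hv, add_assoc]

theorem mul_monomial_mul (hσ : ∀ i j, Commute (σ i) (σ j)) (hv : v ∈ nucleus T)
    (hfix : ∀ k, powComp σ k v = v) (hm : ∀ t, v * powComp σ m t = t * v) (f g : SkewLaurent σ) :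
    f * (monomial σ m v * g) = monomial σ m v * (f * g) := by
  induction f using induction_on with
  | h0 => simp
  | hadd f f' hf hf' => simp only [mul_add, add_mul, hf, hf']
  | hmon k a =>
    induction g using induction_on with
    | h0 => simp
    | hadd g g' hg hg' => simp only [mul_add, hg, hg']
    | hmon l b =>
      simp only [monomial_mul_monomial, map_mul, hfix]
      rw [← mul_assoc_of_mid_mem_nucleus hv, ← mul_assoc_of_left_mem_nucleus hv, hm,
        ← powComp_add_apply hσ, ← powComp_add_apply hσ, add_comm k m, add_left_comm]

/-- The ideal `(1 - v x^m) R`, for a central element `v x^m`. -/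
noncomputable def oneSubIdeal (hσ : ∀ i j, Commute (σ i) (σ j)) (hv : v ∈ nucleus T)
    (hfix : ∀ k, powComp σ k v = v) (hm : ∀ t, v * powComp σ m t = t * v) :
    TwoSidedIdeal (SkewLaurent σ) :=
  TwoSidedIdeal.mk' {g | ∃ f, f - monomial σ m v * f = g}
    ⟨0, by simp⟩
    (by
      rintro _ _ ⟨f, rfl⟩ ⟨g, rfl⟩
      exact ⟨f + g, by rw [mul_add]; abel⟩)
    (by
      rintro _ ⟨f, rfl⟩
      exact ⟨-f, by rw [mul_neg]; abel⟩)
    (by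
      rintro h _ ⟨f, rfl⟩
      exact ⟨h * f, by rw [mul_sub, mul_monomial_mul hσ hv hfix hm]⟩)
    (by
      rintro _ h ⟨f, rfl⟩
      exact ⟨f * h, by rw [sub_mul, monomial_mul_mul hσ hv]⟩)

theorem mem_oneSubIdeal {hσ : ∀ i j, Commute (σ i) (σ j)} {hv : v ∈ nucleus T}
    {hfix : ∀ k, powComp σ k v = v} {hm : ∀ t, v * powComp σ m t = t * v} {g : SkewLaurent σ} :
    g ∈ oneSubIdeal hσ hv hfix hm ↔ ∃ f, f - monomial σ m v * f = g :=
  TwoSidedIdeal.mem_mk' ..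

theorem exists_nat_coeff_smul_eq_zero (f : SkewLaurent σ) (hm : m ≠ 0) :
    ∃ j : ℕ, coeff (j • m) f = 0 := by
  by_contra! h
  have hinj : Function.Injective fun j : ℕ => j • m := by
    intro i j hij
    obtain ⟨l, hl⟩ := Function.ne_iff.1 hm
    exact (by simpa using congrFun hij l : i = j ∨ m l = 0).resolve_right hl
  exact Set.infinite_of_injective_forall_mem hinj
    (fun j => mem_support.2 (h j)) f.support.finite_toSet

/-- Off exponent `0` the equation reads `f_k = v σ^m(f_{k-m})`. A non-zero `f_0` would propagate
along all `j m`, so `f_0 = 0`; then exponent `0` forces `f_{-m} ≠ 0`, which propagates along all `-j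
m`. Either way the support is infinite. -/
theorem sub_monomial_mul_ne_one [Nontrivial T] (hm : m ≠ 0) (hv : ∀ t, v * t = 0 → t = 0)
    (f : SkewLaurent σ) : f - monomial σ m v * f ≠ 1 := by
  intro h
  have key (k) : coeff k f - v * powComp σ m (coeff (k - m) f) = if 0 = k then 1 else 0 := by
    rw [← coeff_monomial_mul, ← map_sub, h, coeff_one]
  have smul_ne (j : ℕ) : (j + 1) • m ≠ 0 := smul_ne_zero j.succ_ne_zero hm
  have h0 : coeff 0 f = 0 := by
    by_contra h0
    obtain ⟨j, hj⟩ := exists_nat_coeff_smul_eq_zero f hm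
    revert hj
    induction j with
    | zero => simpa using h0
    | succ j ih =>
      intro hj
      have := key ((j + 1) • m)
      rw [if_neg (smul_ne j).symm, hj, zero_sub, neg_eq_zero] at this
      have := hv _ this
      rw [EmbeddingLike.map_eq_zero_iff, succ_nsmul, add_sub_cancel_right] at this
      exact ih this
  -- The shift by `x^m` makes the backward ray start at `-m` instead of `0`, where the coefficient
  -- is already known to vanish.
  obtain ⟨j, hj⟩ := exists_nat_coeff_smul_eq_zero
    (f * monomial σ m 1) (neg_ne_zero.2 hm)
  rw [coeff_mul_monomial, map_one, mul_one] at hj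
  revert hj
  induction j with
  | zero =>
    intro hj
    have := key 0
    rw [zero_smul] at hj
    rw [if_pos rfl, hj, h0] at this
    simp at this
  | succ j ih =>
    intro hj
    have := key ((j + 1) • (-m))
    rw [hj, if_neg, map_zero, mul_zero, sub_zero] at this
    · exact ih (by rwa [sub_eq_add_neg, ← succ_nsmul])
    · rw [smul_neg]
      exact (neg_ne_zero.2 (smul_ne j)).symm

theorem not_isSimpleRing_of_central [Nontrivial T] (hσ : ∀ i j, Commute (σ i) (σ j))
    (hv : v ∈ nucleus T) (hv0 : ∀ t, v * t = 0 → t = 0)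
    (hfix : ∀ k, powComp σ k v = v) (hvm : ∀ t, v * powComp σ m t = t * v) (hm : m ≠ 0) :
    ¬ IsSimpleRing (SkewLaurent σ) := by
  intro _
  have h0 : (1 - monomial σ m v : SkewLaurent σ) ≠ 0 := fun h => by
    simpa [coeff_one, coeff_monomial, hm] using congrArg (coeff 0) h
  obtain ⟨f, hf⟩ := mem_oneSubIdeal.1 <| IsSimpleRing.one_mem_of_ne_zero_mem
    (oneSubIdeal hσ hv hfix hvm) h0 (mem_oneSubIdeal.2 ⟨1, by rw [mul_one]⟩)
  exact sub_monomial_mul_ne_one hm hv0 f hf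

end Central

/-! ### Elements of minimal support. -/

section MinimalSupport

/-- A non-zero ideal contains an element of minimal support among its non-zero elements whose
constant coefficient is non-zero. -/
theorem exists_minimal_support {I : TwoSidedIdeal (SkewLaurent σ)} (hI : I ≠ ⊥) :
    ∃ f ∈ I, coeff 0 f ≠ 0 ∧ ∀ g ∈ I, g ≠ 0 → f.support.card ≤ g.support.card := by
  have hne : {f : SkewLaurent σ | f ∈ I ∧ f ≠ 0}.Nonempty := by
    by_contra h
    rw [Set.not_nonempty_iff_eq_empty] at h
    refine hI (le_bot_iff.1 fun f hf => (TwoSidedIdeal.mem_bot _).2 ?_)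
    by_contra hf0
    exact Set.eq_empty_iff_forall_notMem.1 h f ⟨hf, hf0⟩
  obtain ⟨f, ⟨hf, hf0⟩, hmin⟩ :=
    (measure fun f : SkewLaurent σ => f.support.card).wf.has_min _ hne
  obtain ⟨k, hk⟩ : ∃ k, coeff k f ≠ 0 := by
    by_contra! h
    exact hf0 (ext_coeff fun k => by rw [h, map_zero])
  refine ⟨f * monomial σ (-k) 1, I.mul_mem_right _ _ hf, ?_, fun g hg hg0 => ?_⟩
  · rw [coeff_mul_monomial]
    simpa using hk
  · exact (support_shift_card_le _ _).trans (not_lt.1 (hmin g ⟨hg, hg0⟩))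

/-- The constant coefficients of the elements of `I` supported in `S`. -/
noncomputable def constCoeffIdeal (I : TwoSidedIdeal (SkewLaurent σ)) (S : Finset (Fin n → ℤ)) :
    TwoSidedIdeal T :=
  TwoSidedIdeal.mk' {a | ∃ f ∈ I, (∀ k ∉ S, coeff k f = 0) ∧ coeff 0 f = a}
    ⟨0, I.zero_mem, by simp, by simp⟩
    (by
      rintro _ _ ⟨f, hf, hfS, rfl⟩ ⟨g, hg, hgS, rfl⟩
      exact ⟨f + g, I.add_mem hf hg, fun k hk => by simp [hfS k hk, hgS k hk], by simp⟩)
    (by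
      rintro _ ⟨f, hf, hfS, rfl⟩
      exact ⟨-f, I.neg_mem hf, fun k hk => by simp [hfS k hk], by simp⟩)
    (by
      rintro a _ ⟨f, hf, hfS, rfl⟩
      exact ⟨monomial σ 0 a * f, I.mul_mem_left _ _ hf,
        fun k hk => by simp [coeff_C_mul, hfS k hk], coeff_C_mul _ _ _⟩)
    (by
      rintro _ a ⟨f, hf, hfS, rfl⟩
      exact ⟨f * monomial σ 0 a, I.mul_mem_right _ _ hf,
        fun k hk => by simp [coeff_mul_C, hfS k hk], by rw [coeff_mul_C, powComp_zero_apply]⟩)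

theorem mem_constCoeffIdeal {I : TwoSidedIdeal (SkewLaurent σ)} {S : Finset (Fin n → ℤ)} {a : T} :
    a ∈ constCoeffIdeal I S ↔ ∃ f ∈ I, (∀ k ∉ S, coeff k f = 0) ∧ coeff 0 f = a :=
  TwoSidedIdeal.mem_mk' ..

theorem sigma_mem_constCoeffIdeal (I : TwoSidedIdeal (SkewLaurent σ)) (S : Finset (Fin n → ℤ))
    (i : Fin n) (a : T) (ha : a ∈ constCoeffIdeal I S) : σ i a ∈ constCoeffIdeal I S := by
  obtain ⟨f, hf, hfS, rfl⟩ := mem_constCoeffIdeal.1 ha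
  refine mem_constCoeffIdeal.2
    ⟨monomial σ (Pi.single i 1) 1 * f * monomial σ (-Pi.single i 1) 1,
      I.mul_mem_right _ _ (I.mul_mem_left _ _ hf), fun k hk => ?_, ?_⟩
  · rw [coeff_conj, hfS k hk, map_zero]
  · rw [coeff_conj, powComp_single]

/-- In a non-zero ideal `I` over a `σ`-simple ring there is an element with constant coefficient
`1` such that no non-zero element of `I` has a strictly smaller support. -/
theorem exists_monic_minimal (hT : IsSigmaSimple σ) {I : TwoSidedIdeal (SkewLaurent σ)}
    (hI : I ≠ ⊥) :
    ∃ f ∈ I, coeff 0 f = 1 ∧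
      ∀ g ∈ I, coeff 0 g = 0 → (∀ k, coeff k f = 0 → coeff k g = 0) → g = 0 := by
  obtain ⟨p, hp, hp0, hmin⟩ := exists_minimal_support hI
  -- Constant coefficients attainable within the support of `p` form a non-zero σ-stable ideal, so
  -- `1` is attained without enlarging the support.
  have htop : constCoeffIdeal I p.support = ⊤ := by
    refine (hT.2 _ (sigma_mem_constCoeffIdeal I _)).resolve_left fun h => hp0 ?_
    rw [← TwoSidedIdeal.mem_bot T, ← h]
    exact mem_constCoeffIdeal.2 ⟨p, hp, fun k hk => not_not.1 (mt mem_support.2 hk), rfl⟩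
  obtain ⟨f, hf, hfS, hf1⟩ := mem_constCoeffIdeal.1 (TwoSidedIdeal.one_mem _ htop)
  refine ⟨f, hf, hf1, fun g hg hg0 hgf => ?_⟩
  by_contra hne
  refine (hmin g hg hne).not_gt (Finset.card_lt_card ?_)
  rw [Finset.ssubset_iff_of_subset fun k hk => ?_]
  · exact ⟨0, mem_support.2 hp0, fun h => mem_support.1 h hg0⟩
  · by_contra hkp
    exact mem_support.1 hk (hgf k (hfS k hkp))

end MinimalSupport

/-! ### Coefficients of a minimal element. -/

section Coefficients

variable {I : TwoSidedIdeal (SkewLaurent σ)} {f : SkewLaurent σ}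

theorem mul_coeff_of_minimal (hf : f ∈ I) (hf1 : coeff 0 f = 1)
    (hmin : ∀ g ∈ I, coeff 0 g = 0 → (∀ k, coeff k f = 0 → coeff k g = 0) → g = 0)
    (m : Fin n → ℤ) (t : T) : t * coeff m f = coeff m f * powComp σ m t := by
  have h := hmin (monomial σ 0 t * f - f * monomial σ 0 t)
    (I.sub_mem (I.mul_mem_left _ _ hf) (I.mul_mem_right _ _ hf))
    (by simp [coeff_C_mul, coeff_mul_C, hf1, powComp_zero_apply])
    (fun k hk => by simp [coeff_C_mul, coeff_mul_C, hk])
  simpa [coeff_C_mul, coeff_mul_C, sub_eq_zero] using congrArg (coeff m) h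

theorem sigma_coeff_of_minimal (hf : f ∈ I) (hf1 : coeff 0 f = 1)
    (hmin : ∀ g ∈ I, coeff 0 g = 0 → (∀ k, coeff k f = 0 → coeff k g = 0) → g = 0)
    (m : Fin n → ℤ) (i : Fin n) : σ i (coeff m f) = coeff m f := by
  have h := hmin (monomial σ (Pi.single i 1) 1 * f * monomial σ (-Pi.single i 1) 1 - f)
    (I.sub_mem (I.mul_mem_right _ _ (I.mul_mem_left _ _ hf)) hf)
    (by rw [map_sub, coeff_conj, hf1, map_one, sub_self])
    (fun k hk => by rw [map_sub, coeff_conj, hk, map_zero, sub_zero])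
  have := congrArg (coeff m) h
  rwa [map_sub, coeff_conj, powComp_single, map_zero, sub_eq_zero] at this

theorem coeff_mem_nucleus_of_minimal (hf : f ∈ I) (hf1 : coeff 0 f = 1)
    (hmin : ∀ g ∈ I, coeff 0 g = 0 → (∀ k, coeff k f = 0 → coeff k g = 0) → g = 0)
    (m : Fin n → ℤ) : coeff m f ∈ nucleus T := by
  refine ⟨fun s t => ?_, fun s t => ?_, fun s t => ?_⟩
  -- Right multiplication by a constant twists it by `σ^m` at exponent `m`, so right-hand arguments
  -- are first written as images under `σ^m`.
  · obtain ⟨s, rfl⟩ := (powComp σ m).surjective s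
    obtain ⟨t, rfl⟩ := (powComp σ m).surjective t
    have h := hmin (f * monomial σ 0 s * monomial σ 0 t - f * monomial σ 0 (s * t))
      (I.sub_mem (I.mul_mem_right _ _ (I.mul_mem_right _ _ hf)) (I.mul_mem_right _ _ hf))
      (by simp [coeff_mul_C, hf1, powComp_zero_apply])
      (fun k hk => by simp [coeff_mul_C, hk])
    simpa [coeff_mul_C, associator_apply] using congrArg (coeff m) h
  · obtain ⟨t, rfl⟩ := (powComp σ m).surjective t
    have h := hmin
      (monomial σ 0 s * f * monomial σ 0 t - monomial σ 0 s * (f * monomial σ 0 t))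
      (I.sub_mem (I.mul_mem_right _ _ (I.mul_mem_left _ _ hf))
        (I.mul_mem_left _ _ (I.mul_mem_right _ _ hf)))
      (by simp [coeff_C_mul, coeff_mul_C, hf1, powComp_zero_apply])
      (fun k hk => by simp [coeff_C_mul, coeff_mul_C, hk])
    simpa [coeff_C_mul, coeff_mul_C, associator_apply] using congrArg (coeff m) h
  · have h := hmin (monomial σ 0 (s * t) * f - monomial σ 0 s * (monomial σ 0 t * f))
      (I.sub_mem (I.mul_mem_left _ _ hf) (I.mul_mem_left _ _ (I.mul_mem_left _ _ hf)))
      (by simp [coeff_C_mul, hf1])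
      (fun k hk => by simp [coeff_C_mul, hk])
    simpa [coeff_C_mul, associator_apply] using congrArg (coeff m) h

end Coefficients

end SkewLaurent

/-! ### Normalizing elements are units. -/

section Invertibility

variable {T : Type*} [NonAssocRing T] {n : ℕ} {σ : Fin n → RingAut T} {w : T}

/-- The ideal `w T = T w`, for a nuclear element `w` normalizing `T`. -/
def normalIdeal (hw : w ∈ nucleus T) (φ : RingAut T) (hφ : ∀ t, t * w = w * φ t) :
    TwoSidedIdeal T :=
  TwoSidedIdeal.mk' {a | ∃ t, w * t = a}
    ⟨0, mul_zero w⟩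
    (by
      rintro _ _ ⟨s, rfl⟩ ⟨t, rfl⟩
      exact ⟨s + t, mul_add w s t⟩)
    (by
      rintro _ ⟨t, rfl⟩
      exact ⟨-t, mul_neg w t⟩)
    (by
      rintro a _ ⟨t, rfl⟩
      exact ⟨φ a * t, by
        rw [← mul_assoc_of_left_mem_nucleus hw, ← hφ, mul_assoc_of_mid_mem_nucleus hw]⟩)
    (by
      rintro _ a ⟨t, rfl⟩
      exact ⟨t * a, (mul_assoc_of_left_mem_nucleus hw t a).symm⟩)

theorem mem_normalIdeal {hw : w ∈ nucleus T} {φ : RingAut T} {hφ : ∀ t, t * w = w * φ t} {a : T} :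
    a ∈ normalIdeal hw φ hφ ↔ ∃ t, w * t = a :=
  TwoSidedIdeal.mem_mk' ..

theorem IsSigmaSimple.exists_inverse (hT : IsSigmaSimple σ) (hw : w ∈ nucleus T) (hw0 : w ≠ 0)
    (hfix : ∀ i, σ i w = w) (φ : RingAut T) (hφ : ∀ t, t * w = w * φ t) :
    ∃ u, u * w = 1 ∧ w * u = 1 := by
  have htop : normalIdeal hw φ hφ = ⊤ := by
    refine (hT.2 _ fun i a ha => ?_).resolve_left fun h => hw0 ?_
    · obtain ⟨t, rfl⟩ := mem_normalIdeal.1 ha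
      exact mem_normalIdeal.2 ⟨σ i t, by rw [map_mul, hfix]⟩
    · rw [← TwoSidedIdeal.mem_bot T, ← h]
      exact mem_normalIdeal.2 ⟨1, mul_one w⟩
  obtain ⟨u, hu⟩ := mem_normalIdeal.1 (TwoSidedIdeal.one_mem _ htop)
  -- With the right inverse written as `φ x`, the relation `x w = w φ(x)` makes `x` a left inverse;
  -- middle nuclearity of `w` identifies the two.
  obtain ⟨x, rfl⟩ := φ.surjective u
  have hx : x * w = 1 := (hφ x).trans hu
  have : x = φ x := by
    have := mul_assoc_of_mid_mem_nucleus hw x (φ x)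
    rw [hx, hu, one_mul, mul_one] at this
    exact this.symm
  exact ⟨x, hx, (congrArg (w * ·) this).trans hu⟩

end Invertibility

theorem mainTheorem4 {T : Type*} [NonAssocRing T] {n : ℕ} (hn : 0 < n) (σ : Fin n → RingAut T)
    (hσ : ∀ i j, Commute (σ i) (σ j)) :
    IsSimpleRing (SkewLaurent σ) ↔
      IsSigmaSimple σ ∧
        ¬ ∃ u v : T, u ∈ nucleus T ∧ u * v = 1 ∧ v * u = 1 ∧ (∀ i, σ i u = u) ∧
          ∃ m : Fin n → ℤ, m ≠ 0 ∧ ∀ t : T, powComp σ m t = u * t * v := by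
  constructor
  · intro hR
    have hT : IsSigmaSimple σ := IsSimpleRing.isSigmaSimple hσ
    refine ⟨hT, ?_⟩
    rintro ⟨u, v, hu, huv, hvu, hfix, m, hm, hum⟩
    have := hT.1
    have hv := mem_nucleus_of_inverse hu huv hvu
    have hvux (x : T) : v * (u * x) = x := by
      rw [← mul_assoc_of_left_mem_nucleus hv, hvu, one_mul]
    have huvx (x : T) : u * (v * x) = x := by
      rw [← mul_assoc_of_left_mem_nucleus hu, huv, one_mul]
    refine SkewLaurent.not_isSimpleRing_of_central hσ hv (fun t ht => ?_)
      (powComp_fixed fun i => ?_) (fun t => ?_) hm hR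
    · rw [← huvx t, ht, mul_zero]
    · exact map_eq_of_inverse hu huv hvu (hfix i)
    · rw [hum, mul_assoc_of_left_mem_nucleus hu, hvux]
  · rintro ⟨hT, hu⟩
    have : Nontrivial (SkewLaurent σ) := SkewLaurent.nontrivial_iff.2 hT.1
    refine IsSimpleRing.of_eq_bot_or_eq_top fun I => or_iff_not_imp_left.2 fun hI => ?_
    obtain ⟨f, hf, hf1, hmin⟩ := SkewLaurent.exists_monic_minimal hT hI
    suffices hf_one : f = 1 from (TwoSidedIdeal.one_mem_iff I).1 (hf_one ▸ hf)
    refine SkewLaurent.ext_coeff fun m => ?_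
    rw [SkewLaurent.coeff_one]
    split_ifs with hm
    · rw [← hm, hf1]
    by_contra hw0
    have hw := SkewLaurent.coeff_mem_nucleus_of_minimal hf hf1 hmin m
    have hfix := SkewLaurent.sigma_coeff_of_minimal hf hf1 hmin m
    have hcomm := SkewLaurent.mul_coeff_of_minimal hf hf1 hmin m
    obtain ⟨u, huw, hwu⟩ := hT.exists_inverse hw hw0 hfix _ hcomm
    have hun := mem_nucleus_of_inverse hw hwu huw
    -- The forbidden unit is the inverse of the coefficient `w`: from `t w = w σ^m(t)` one gets
    -- `σ^m(t) = w⁻¹ t w`.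
    refine hu ⟨u, SkewLaurent.coeff m f, hun, huw, hwu, fun i => ?_, m, Ne.symm hm, fun t => ?_⟩
    · exact map_eq_of_inverse hw hwu huw (hfix i)
    · rw [mul_assoc_of_left_mem_nucleus hun, hcomm, ← mul_assoc_of_left_mem_nucleus hun, huw,
        one_mul]
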